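/- **Theorem 2.8.** All graphs are finite and simple. A graph is called a *cactus* if any two distinct cycles of it have at most one vertex in common. The *spectral radius* $\rho(G)$ of a graph $G$ is the largest eigenvalue of its adjacency matrix. Let $n\ge 1$ and let $G$ be a connected cactus with $n$ vertices which is *edge maximal*, that is, for any two distinct non-adjacent vertices $u,v$ of $G$ the graph $G+uv$ is not a cactus. Then there is a connected cactus $G^*$ with $n$ vertices which has the maximal number of edges among all connected cacti with $n$ vertices and satisfies $$\rho(G)\le\rho(G^*).$$ -/

import Mathlib

/-- The spectral radius (index) of a finite simple graph: the largest eigenvalue of its real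
adjacency matrix (see `graphSpectralRadius_isGreatest` for the fact that it is attained). -/
noncomputable def graphSpectralRadius {V : Type*} [Fintype V] (G : SimpleGraph V) : ℝ :=
  open Classical in
  sSup {μ : ℝ | Module.End.HasEigenvalue (Matrix.toLin' (G.adjMatrix ℝ)) μ}

/-- On a nonempty vertex set, the spectral radius is the greatest eigenvalue. -/
theorem graphSpectralRadius_isGreatest {V : Type*} [Fintype V] [Nonempty V] [DecidableEq V]
    (G : SimpleGraph V) [DecidableRel G.Adj] :
    IsGreatest {μ : ℝ | Module.End.HasEigenvalue (Matrix.toLin' (G.adjMatrix ℝ)) μ}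
      (graphSpectralRadius G) := by
  have hS : {μ : ℝ | Module.End.HasEigenvalue (Matrix.toLin' (G.adjMatrix ℝ)) μ} =
      spectrum ℝ (G.adjMatrix ℝ) := by
    ext μ
    rw [Set.mem_ofPred_eq, Module.End.hasEigenvalue_iff_mem_spectrum, Matrix.spectrum_toLin']
  have hA : (G.adjMatrix ℝ).IsHermitian := by
    rw [Matrix.IsHermitian, Matrix.conjTranspose_eq_transpose_of_trivial]
    exact G.transpose_adjMatrix
  have hdef : graphSpectralRadius G =
      sSup {μ : ℝ | Module.End.HasEigenvalue (Matrix.toLin' (G.adjMatrix ℝ)) μ} := by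
    unfold graphSpectralRadius
    congr!
  rw [hdef, hS, hA.spectrum_real_eq_range_eigenvalues]
  exact ⟨(Set.range_nonempty _).csSup_mem (Set.finite_range _),
    fun _ h => le_csSup (Set.finite_range _).bddAbove h⟩

/-- A graph is a cactus if any two of its distinct cycles have at most one common vertex.
Cycles are identified with the subgraphs that they trace out, so that a change of base point or
of orientation does not give a different cycle. Connectedness is not part of the definition. -/
def IsCactus {V : Type*} (G : SimpleGraph V) : Prop :=
  ∀ ⦃u v : V⦄ (p : G.Walk u u) (q : G.Walk v v), p.IsCycle → q.IsCycle →
    p.toSubgraph ≠ q.toSubgraph → {w : V | w ∈ p.support ∧ w ∈ q.support}.Subsingleton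

/-- A connected cactus that stops being a cactus whenever an edge is added to it. -/
structure IsEdgeMaximalConnectedCactus {V : Type*} (G : SimpleGraph V) : Prop where
  connected : G.Connected
  isCactus : IsCactus G
  not_isCactus_add : ∀ u v : V, u ≠ v → ¬ G.Adj u v → ¬ IsCactus (G ⊔ SimpleGraph.edge u v)

/-- A connected cactus that has the maximal number of edges among all connected cacti on the
same finite vertex set, that is, among all connected cacti of the same order. -/
structure IsMaximumConnectedCactus {V : Type*} [Fintype V] (G : SimpleGraph V) : Prop where
  connected : G.Connected
  isCactus : IsCactus G
  ncard_edgeSet_le : ∀ H : SimpleGraph V, H.Connected → IsCactus H →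
    H.edgeSet.ncard ≤ G.edgeSet.ncard

/-! Let `A` be the adjacency matrix, `ρ` its largest eigenvalue and `𝟙` the all-ones vector. In a
cactus, two cycles sharing an edge have the same vertices. Counting walks of length two from a
vertex then gives `A²𝟙 ≤ (n - 1)𝟙 + A𝟙` entrywise (`sum_degree_neighborFinset_le`), and pairing with
a nonnegative eigenvector for `ρ` yields `ρ² - ρ ≤ n - 1`.

For even `n` this is sharpened through the defect `D = (n - 1)𝟙 + A𝟙 - A²𝟙 ≥ 0`. A parity argument
shows that every non-isolated vertex has a neighbour with positive defect
(`exists_adj_sum_degree_lt`). When no vertex is isolated, `AD ≥ 𝟙`, and pairing gives `ρ³ - ρ² - (n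
- 1)ρ + 1 ≤ 0`.

The candidate `G*` is a windmill: triangles through one centre, plus a pendant vertex if `n` is
even. Explicit eigenvectors make every real root of `t² - t = n - 1`, respectively of the cubic, a
lower bound for its spectral radius. The intermediate value theorem provides a root that is at least
`ρ(G)`. Fundamental cycles of a spanning tree show that the windmill has the most edges. -/

/-! ### Short cycles in a cactus -/

namespace SimpleGraph
variable {V : Type*} {G : SimpleGraph V}

theorem exists_isCycle_three {a b c : V} (hab : G.Adj a b) (hbc : G.Adj b c) (hca : G.Adj c a) :
    ∃ p : G.Walk a a, p.IsCycle ∧ ∀ w, w ∈ p.support ↔ w = a ∨ w = b ∨ w = c := by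
  refine ⟨.cons hab (.cons hbc (.cons hca .nil)), ?_, fun w => by simp; tauto⟩
  have h1 := hab.ne
  have h2 := hbc.ne
  have h3 := hca.ne
  rw [Walk.cons_isCycle_iff]
  simp [Walk.cons_isPath_iff]
  grind

theorem exists_isCycle_four {a b c d : V} (hab : G.Adj a b) (hbc : G.Adj b c) (hcd : G.Adj c d)
    (hda : G.Adj d a) (hac : a ≠ c) (hbd : b ≠ d) :
    ∃ p : G.Walk a a, p.IsCycle ∧ ∀ w, w ∈ p.support ↔ w = a ∨ w = b ∨ w = c ∨ w = d := by
  refine ⟨.cons hab (.cons hbc (.cons hcd (.cons hda .nil))), ?_, fun w => by simp; tauto⟩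
  have h1 := hab.ne
  have h2 := hbc.ne
  have h3 := hcd.ne
  have h4 := hda.ne
  rw [Walk.cons_isCycle_iff]
  simp [Walk.cons_isPath_iff]
  grind

theorem exists_isCycle_five {a b c d e : V} (hab : G.Adj a b) (hbc : G.Adj b c) (hcd : G.Adj c d)
    (hde : G.Adj d e) (hea : G.Adj e a) (hac : a ≠ c) (had : a ≠ d) (hbd : b ≠ d) (hbe : b ≠ e)
    (hce : c ≠ e) :
    ∃ p : G.Walk a a, p.IsCycle ∧
      ∀ w, w ∈ p.support ↔ w = a ∨ w = b ∨ w = c ∨ w = d ∨ w = e := by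
  refine ⟨.cons hab (.cons hbc (.cons hcd (.cons hde (.cons hea .nil)))), ?_,
    fun w => by simp; tauto⟩
  have h1 := hab.ne
  have h2 := hbc.ne
  have h3 := hcd.ne
  have h4 := hde.ne
  have h5 := hea.ne
  rw [Walk.cons_isCycle_iff]
  simp [Walk.cons_isPath_iff]
  grind

end SimpleGraph

namespace IsCactus
open SimpleGraph
variable {V : Type*} {G : SimpleGraph V}

theorem mem_support_iff (hG : IsCactus G) {u v a b : V} {p : G.Walk u u} {q : G.Walk v v}
    (hp : p.IsCycle) (hq : q.IsCycle) (hab : a ≠ b) (hap : a ∈ p.support) (haq : a ∈ q.support)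
    (hbp : b ∈ p.support) (hbq : b ∈ q.support) (w : V) : w ∈ p.support ↔ w ∈ q.support := by
  by_cases h : p.toSubgraph = q.toSubgraph
  · rw [← Walk.mem_verts_toSubgraph, h, Walk.mem_verts_toSubgraph]
  · exact absurd (hG p q hp hq h ⟨hap, haq⟩ ⟨hbp, hbq⟩) hab

theorem triangle_unique (hG : IsCactus G) {a b x y : V} (hab : G.Adj a b) (hax : G.Adj a x)
    (hbx : G.Adj b x) (hay : G.Adj a y) (hby : G.Adj b y) : x = y := by
  obtain ⟨p, hp, hps⟩ := exists_isCycle_three hab hbx hax.symm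
  obtain ⟨q, hq, hqs⟩ := exists_isCycle_three hab hby hay.symm
  have hpq := hG.mem_support_iff hp hq hab.ne (by simp) (by simp) (by simp [hps]) (by simp [hqs])
  simp only [hps, hqs] at hpq
  have e1 := hpq x
  have h1 := hax.ne
  have h2 := hbx.ne
  grind

/-- Both cycles contain the edge `ab`, so they would have the same vertex set, but one has three
vertices and the other four. -/
theorem not_triangle_four (hG : IsCactus G) {a b c d x : V} (hab : G.Adj a b) (hbc : G.Adj b c)
    (hcd : G.Adj c d) (hda : G.Adj d a) (hac : a ≠ c) (hbd : b ≠ d) (hax : G.Adj a x)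
    (hbx : G.Adj b x) : False := by
  obtain ⟨p, hp, hps⟩ := exists_isCycle_three hab hbx hax.symm
  obtain ⟨q, hq, hqs⟩ := exists_isCycle_four hab hbc hcd hda hac hbd
  have hpq := hG.mem_support_iff hp hq hab.ne (by simp) (by simp) (by simp [hps]) (by simp [hqs])
  simp only [hps, hqs] at hpq
  have e1 := hpq d
  have e2 := hpq c
  have h1 := hda.ne
  have h2 := hbc.ne
  have h3 := hcd.ne
  grind

theorem not_triangle_five (hG : IsCactus G) {a b c d e x : V} (hab : G.Adj a b) (hbc : G.Adj b c)
    (hcd : G.Adj c d) (hde : G.Adj d e) (hea : G.Adj e a) (hac : a ≠ c) (had : a ≠ d)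
    (hbd : b ≠ d) (hbe : b ≠ e) (hce : c ≠ e) (hax : G.Adj a x) (hbx : G.Adj b x) : False := by
  obtain ⟨p, hp, hps⟩ := exists_isCycle_three hab hbx hax.symm
  obtain ⟨q, hq, hqs⟩ := exists_isCycle_five hab hbc hcd hde hea hac had hbd hbe hce
  have hpq := hG.mem_support_iff hp hq hab.ne (by simp) (by simp) (by simp [hps]) (by simp [hqs])
  simp only [hps, hqs] at hpq
  have e1 := hpq d
  have e2 := hpq c
  have h2 := hbc.ne
  have h3 := hcd.ne
  grind

theorem four_cycle_eq_or_eq (hG : IsCactus G) {a b c d x : V} (hab : G.Adj a b)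
    (hbc : G.Adj b c) (hcd : G.Adj c d) (hda : G.Adj d a) (hac : a ≠ c) (hbd : b ≠ d)
    (hax : G.Adj a x) (hxc : G.Adj x c) : x = b ∨ x = d := by
  by_contra! hx
  obtain ⟨p, hp, hps⟩ := exists_isCycle_four hab hbc hxc.symm hax.symm hac hx.1.symm
  obtain ⟨q, hq, hqs⟩ := exists_isCycle_four hab hbc hcd hda hac hbd
  have hpq := hG.mem_support_iff hp hq hab.ne (by simp) (by simp) (by simp [hps]) (by simp [hqs])
  simp only [hps, hqs] at hpq
  have e1 := hpq x
  have h1 := hax.ne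
  have h3 := hxc.ne
  grind

/-- Two 4-cycles on `ab` have the same vertices, so `c ≠ c'` forces `c' = d`; then `abd` is a
triangle sharing the edge `ab` with a 4-cycle. -/
theorem four_cycle_opposite_unique (hG : IsCactus G) {a b c d c' d' : V} (hab : G.Adj a b)
    (hbc : G.Adj b c) (hcd : G.Adj c d) (hda : G.Adj d a) (hac : a ≠ c) (hbd : b ≠ d)
    (hbc' : G.Adj b c') (hcd' : G.Adj c' d') (hda' : G.Adj d' a) (hac' : a ≠ c') (hbd' : b ≠ d') :
    c = c' := by
  by_contra h
  obtain ⟨p, hp, hps⟩ := exists_isCycle_four hab hbc hcd hda hac hbd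
  obtain ⟨q, hq, hqs⟩ := exists_isCycle_four hab hbc' hcd' hda' hac' hbd'
  have hpq := hG.mem_support_iff hp hq hab.ne (by simp) (by simp) (by simp [hps]) (by simp [hqs])
  simp only [hps, hqs] at hpq
  have e1 := hpq c'
  have h1 : c' = d := by
    have := hbc'.ne
    grind
  subst h1
  exact hG.not_triangle_four hab hbc hcd hda hac hbd hda.symm hbc'

end IsCactus

/-! ### Counting walks of length two -/

namespace SimpleGraph
variable {V : Type*} {G : SimpleGraph V} [Fintype V] [DecidableEq V] [DecidableRel G.Adj]

theorem sum_degree_neighborFinset (v : V) :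
    ∑ u ∈ G.neighborFinset v, G.degree u =
      ∑ w, (G.neighborFinset v ∩ G.neighborFinset w).card := by
  have h := Finset.sum_card_bipartiteAbove_eq_sum_card_bipartiteBelow (s := G.neighborFinset v)
    (t := Finset.univ) (r := G.Adj)
  convert h using 2 with u _ w _
  · rw [← card_neighborFinset_eq_degree]
    congr 1
    ext w
    simp [Finset.bipartiteAbove]
  · congr 1
    ext u
    simp [Finset.bipartiteBelow, G.adj_comm]

end SimpleGraph

namespace IsCactus
open SimpleGraph
variable {V : Type*} {G : SimpleGraph V} [Fintype V] [DecidableEq V] [DecidableRel G.Adj]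

theorem card_inter_neighborFinset_le_two (hG : IsCactus G) {v w : V} (hvw : v ≠ w) :
    (G.neighborFinset v ∩ G.neighborFinset w).card ≤ 2 := by
  by_contra! h
  obtain ⟨a, ha, b, hb, c, hc, hab, hac, hbc⟩ := Finset.two_lt_card.1 h
  simp only [Finset.mem_inter, mem_neighborFinset] at ha hb hc
  have := hG.four_cycle_eq_or_eq ha.1 ha.2.symm hb.2 hb.1.symm hvw hab hc.1 hc.2.symm
  grind

/-- If `v` and `w` have common neighbours `a ≠ b`, then `vawb` is a 4-cycle. Hence `a` shares no
neighbour with `v`, as that would put a triangle on `va`, and `a` determines `w`. Distinct such `w`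
thus yield disjoint pairs of vertices having no common neighbour with `v`. -/
theorem two_mul_card_le (hG : IsCactus G) (v : V) :
    2 * ((Finset.univ.erase v).filter
        fun w => (G.neighborFinset v ∩ G.neighborFinset w).card = 2).card ≤
      ((Finset.univ.erase v).filter
        fun w => (G.neighborFinset v ∩ G.neighborFinset w).card = 0).card := by
  have key : ∀ w, v ≠ w → (G.neighborFinset v ∩ G.neighborFinset w).card = 2 →
      ∀ a, G.Adj v a → G.Adj w a → ∃ b, a ≠ b ∧ G.Adj v b ∧ G.Adj w b := by
    intro w _ hw a hva hwa
    obtain ⟨b, hb, hba⟩ := Finset.exists_mem_ne (s := G.neighborFinset v ∩ G.neighborFinset w)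
      (by omega) a
    simp only [Finset.mem_inter, mem_neighborFinset] at hb
    exact ⟨b, hba.symm, hb.1, hb.2⟩
  set T := (Finset.univ.erase v).filter
    fun w => (G.neighborFinset v ∩ G.neighborFinset w).card = 2 with hT
  have hdisj : (T : Set V).PairwiseDisjoint
      fun w => G.neighborFinset v ∩ G.neighborFinset w := by
    intro w hw w' hw' hne
    rw [Function.onFun, Finset.disjoint_left]
    intro a ha ha'
    simp only [Finset.mem_inter, mem_neighborFinset, hT, Finset.coe_filter, Finset.mem_erase,
      Finset.mem_univ, and_true, Set.mem_ofPred_eq] at ha ha' hw hw'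
    obtain ⟨b, hab, hb, hwb⟩ := key w hw.1.symm hw.2 a ha.1 ha.2
    obtain ⟨b', hab', hb', hwb'⟩ := key w' hw'.1.symm hw'.2 a ha'.1 ha'.2
    exact hne (hG.four_cycle_opposite_unique ha.1 ha.2.symm hwb hb.symm hw.1.symm hab
      ha'.2.symm hwb' hb'.symm hw'.1.symm hab')
  have hcard : (T.biUnion fun w => G.neighborFinset v ∩ G.neighborFinset w).card = 2 * T.card := by
    rw [Finset.card_biUnion hdisj, Finset.sum_congr rfl (g := fun _ => 2), Finset.sum_const,
      smul_eq_mul, mul_comm]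
    intro w hw
    exact (Finset.mem_filter.1 hw).2
  rw [← hcard]
  apply Finset.card_le_card
  intro a ha
  simp only [Finset.mem_biUnion, Finset.mem_inter, mem_neighborFinset, hT, Finset.mem_filter,
    Finset.mem_erase, Finset.mem_univ, and_true] at ha
  obtain ⟨w, ⟨hwv, hw⟩, hva, hwa⟩ := ha
  obtain ⟨b, hab, hb, hwb⟩ := key w hwv.symm hw a hva hwa
  simp only [Finset.mem_filter, Finset.mem_erase, Finset.mem_univ, and_true, Finset.card_eq_zero]
  refine ⟨hva.ne', Finset.eq_empty_of_forall_notMem fun x hx => ?_⟩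
  simp only [Finset.mem_inter, mem_neighborFinset] at hx
  exact hG.not_triangle_four hva hwa.symm hwb hb.symm hwv.symm hab hx.1 hx.2

theorem sum_degree_neighborFinset_add (hG : IsCactus G) (v : V) :
    ∑ u ∈ G.neighborFinset v, G.degree u +
      ((Finset.univ.erase v).filter
        fun w => (G.neighborFinset v ∩ G.neighborFinset w).card = 0).card =
      Fintype.card V - 1 + G.degree v + ((Finset.univ.erase v).filter
        fun w => (G.neighborFinset v ∩ G.neighborFinset w).card = 2).card := by
  rw [sum_degree_neighborFinset, ← Finset.add_sum_erase _ _ (Finset.mem_univ v),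
    Finset.inter_self, card_neighborFinset_eq_degree, Finset.card_filter, Finset.card_filter,
    add_assoc, ← Finset.sum_add_distrib]
  -- For `k ≤ 2` common neighbours, `k + [k = 0] = 1 + [k = 2]`; the term `w = v`, split off before,
  -- is the degree of `v`.
  have : ∀ w ∈ Finset.univ.erase v, (G.neighborFinset v ∩ G.neighborFinset w).card +
      (if (G.neighborFinset v ∩ G.neighborFinset w).card = 0 then 1 else 0) =
      1 + if (G.neighborFinset v ∩ G.neighborFinset w).card = 2 then 1 else 0 := by
    intro w hw
    have := hG.card_inter_neighborFinset_le_two (Finset.ne_of_mem_erase hw).symm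
    interval_cases (G.neighborFinset v ∩ G.neighborFinset w).card <;> simp
  rw [Finset.sum_congr rfl this, Finset.sum_add_distrib]
  simp [Finset.card_erase_of_mem]
  ring

theorem sum_degree_neighborFinset_le (hG : IsCactus G) (v : V) :
    ∑ u ∈ G.neighborFinset v, G.degree u ≤ Fintype.card V - 1 + G.degree v := by
  have h1 := hG.sum_degree_neighborFinset_add v
  have h2 := hG.two_mul_card_le v
  omega

theorem card_inter_eq_one (hG : IsCactus G) {v : V}
    (h : ∑ u ∈ G.neighborFinset v, G.degree u = Fintype.card V - 1 + G.degree v) {w : V}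
    (hw : w ≠ v) : (G.neighborFinset v ∩ G.neighborFinset w).card = 1 := by
  have h1 := hG.sum_degree_neighborFinset_add v
  have h2 := hG.two_mul_card_le v
  have h0 : ((Finset.univ.erase v).filter
        fun w => (G.neighborFinset v ∩ G.neighborFinset w).card = 0).card = 0 := by omega
  have h2 : ((Finset.univ.erase v).filter
        fun w => (G.neighborFinset v ∩ G.neighborFinset w).card = 2).card = 0 := by omega
  rw [Finset.card_eq_zero, Finset.filter_eq_empty_iff] at h0 h2
  have h3 := hG.card_inter_neighborFinset_le_two hw.symm
  have h0 := h0 (Finset.mem_erase.2 ⟨hw, Finset.mem_univ w⟩)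
  have h2 := h2 (Finset.mem_erase.2 ⟨hw, Finset.mem_univ w⟩)
  omega

end IsCactus

/-! ### Parity and strict inequality for even order -/

namespace SimpleGraph
variable {V : Type*} {G : SimpleGraph V} [Fintype V] [DecidableEq V] [DecidableRel G.Adj]

/-- Sending a neighbour `w` of `u` to the unique common neighbour of `u` and `w` is a
fixed-point-free involution of the neighbourhood of `u`. -/
theorem even_degree_of_card_inter_eq_one {u : V}
    (h : ∀ w, G.Adj u w → (G.neighborFinset u ∩ G.neighborFinset w).card = 1) :
    Even (G.degree u) := by
  have hex : ∀ w, G.Adj u w → ∃ x, G.neighborFinset u ∩ G.neighborFinset w = {x} :=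
    fun w hw => Finset.card_eq_one.1 (h w hw)
  choose f hf using hex
  have hmem : ∀ w hw x, (G.Adj u x ∧ G.Adj w x) ↔ x = f w hw := by
    intro w hw x
    rw [← Finset.mem_singleton, ← hf w hw]
    simp
  have hsum : ∑ w ∈ G.neighborFinset u, (1 : ZMod 2) = 0 := by
    refine Finset.sum_involution (fun w hw => f w ((mem_neighborFinset _ _ _).1 hw))
      (fun _ _ => by decide) (fun w hw _ => ?_) (fun w hw => ?_) (fun w hw => ?_)
    · exact ((hmem w _ _).2 rfl).2.ne'
    · rw [mem_neighborFinset]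
      exact ((hmem w _ _).2 rfl).1
    · have hw' := (mem_neighborFinset _ _ _).1 hw
      exact ((hmem _ ((hmem w hw' _).2 rfl).1 w).1 ⟨hw', ((hmem w hw' _).2 rfl).2.symm⟩).symm
  rw [Finset.sum_const, card_neighborFinset_eq_degree, nsmul_eq_mul, mul_one,
    ZMod.natCast_eq_zero_iff_even] at hsum
  exact hsum

end SimpleGraph

namespace IsCactus
open SimpleGraph
variable {V : Type*} {G : SimpleGraph V} [Fintype V] [DecidableEq V] [DecidableRel G.Adj]

/-- Otherwise every neighbour of `v` has exactly one common neighbour with each other vertex. Parity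
produces a vertex `w` of odd degree at distance one from such a neighbour `u`, and a third neighbour
of `w` closes a 5-cycle sharing an edge with a triangle at `v`. -/
theorem exists_adj_sum_degree_lt (hG : IsCactus G) (hn : Even (Fintype.card V)) {v : V}
    (hv : ∃ u, G.Adj v u) : ∃ u, G.Adj v u ∧
      ∑ w ∈ G.neighborFinset u, G.degree w < Fintype.card V - 1 + G.degree u := by
  by_contra! hcon
  have hone : ∀ u, G.Adj v u → ∀ w, w ≠ u →
      (G.neighborFinset u ∩ G.neighborFinset w).card = 1 := fun u hu w hw =>
    hG.card_inter_eq_one (le_antisymm (hG.sum_degree_neighborFinset_le u) (hcon u hu)) hw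
  have hcommon : ∀ u, G.Adj v u → ∀ w, w ≠ u → ∃ x, G.Adj u x ∧ G.Adj w x := by
    intro u hu w hw
    obtain ⟨x, hx⟩ := Finset.card_eq_one.1 (hone u hu w hw)
    refine ⟨x, ?_⟩
    have : x ∈ G.neighborFinset u ∩ G.neighborFinset w := by simp [hx]
    simpa using this
  have heven : ∀ u, G.Adj v u → Even (G.degree u) := fun u hu =>
    even_degree_of_card_inter_eq_one fun w hw => hone u hu w hw.ne'
  have hveven : Even (G.degree v) := even_degree_of_card_inter_eq_one fun u hu => by
    rw [Finset.inter_comm]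
    exact hone u hu v hu.ne
  obtain ⟨u, hvu⟩ := hv
  -- The degrees around `u` add up to `n - 1 + deg u`, which is odd since `n` and `deg u` are even.
  obtain ⟨w, huw, hw⟩ : ∃ w, G.Adj u w ∧ ¬ Even (G.degree w) := by
    by_contra! h
    have h1 : Even (∑ w ∈ G.neighborFinset u, G.degree w) :=
      Finset.even_sum _ fun w hw => h w ((mem_neighborFinset _ _ _).1 hw)
    rw [le_antisymm (hG.sum_degree_neighborFinset_le u) (hcon u hvu)] at h1
    have h2 := heven u hvu
    have h3 : 0 < Fintype.card V := Fintype.card_pos_iff.2 ⟨u⟩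
    grind
  obtain ⟨u', huu', hvu'⟩ := hcommon u hvu v hvu.ne
  have hwv : w ≠ v := fun h => hw (h ▸ hveven)
  have hwu' : w ≠ u' := fun h => hw (heven w (h ▸ hvu'))
  have hnadj : ¬ G.Adj w u' := fun h => hwv (hG.triangle_unique huu' huw h.symm hvu.symm hvu'.symm)
  obtain ⟨w', huw', hww'⟩ := hcommon u hvu w huw.ne'
  -- An odd degree excludes that `u` and `w'` are the only neighbours of `w`.
  obtain ⟨x, hwx, hxu, hxw'⟩ : ∃ x, G.Adj w x ∧ x ≠ u ∧ x ≠ w' := by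
    by_contra! h
    have : G.neighborFinset w = {u, w'} := by
      ext x
      simp only [mem_neighborFinset, Finset.mem_insert, Finset.mem_singleton]
      refine ⟨fun hx => or_iff_not_imp_left.2 (h x hx), ?_⟩
      rintro (rfl | rfl)
      exacts [huw.symm, hww']
    rw [← card_neighborFinset_eq_degree, this, Finset.card_pair huw'.ne] at hw
    exact hw even_two
  have hxu' : x ≠ u' := by
    rintro rfl
    exact hnadj hwx
  obtain ⟨z, hu'z, hxz⟩ := hcommon u' hvu' x hxu'
  -- The 5-cycle `u u' z x w` and the triangle `u u' v` share the edge `uu'`.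
  refine hG.not_triangle_five huu' hu'z hxz.symm hwx.symm huw.symm ?_ hxu.symm hxu'.symm hwu'.symm
    ?_ hvu.symm hvu'.symm
  · rintro rfl
    exact hxw' (hG.triangle_unique huw hxz.symm hwx huw' hww')
  · rintro rfl
    exact hnadj hu'z.symm

end IsCactus

/-! ### A nonnegative eigenvector for the spectral radius -/

namespace SimpleGraph
variable {V : Type*} [Fintype V] [DecidableEq V] (G : SimpleGraph V) [DecidableRel G.Adj]

theorem le_graphSpectralRadius [Nonempty V] {μ : ℝ} {x : V → ℝ} (hx : x ≠ 0)
    (h : ∀ v, ∑ u ∈ G.neighborFinset v, x u = μ * x v) : μ ≤ graphSpectralRadius G := by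
  refine (graphSpectralRadius_isGreatest G).2
    (Module.End.hasEigenvalue_of_hasEigenvector (x := x) ⟨?_, hx⟩)
  rw [Module.End.mem_eigenspace_iff]
  ext v
  simp [adjMatrix_mulVec_apply, h]

theorem posSemidef_graphSpectralRadius_sub_adjMatrix [Nonempty V] :
    (graphSpectralRadius G • (1 : Matrix V V ℝ) - G.adjMatrix ℝ).PosSemidef := by
  have hA : (G.adjMatrix ℝ).IsHermitian := by
    rw [Matrix.IsHermitian, Matrix.conjTranspose_eq_transpose_of_trivial]
    exact G.transpose_adjMatrix
  have hM : (graphSpectralRadius G • (1 : Matrix V V ℝ) - G.adjMatrix ℝ).IsHermitian := by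
    refine Matrix.IsHermitian.sub ?_ hA
    rw [Matrix.IsHermitian, Matrix.conjTranspose_eq_transpose_of_trivial]
    simp
  rw [hM.posSemidef_iff_eigenvalues_nonneg]
  intro i
  have hv := hM.mulVec_eigenvectorBasis i
  have hne : (hM.eigenvectorBasis i).ofLp ≠ 0 := fun h => hM.eigenvectorBasis.orthonormal.ne_zero i
    (by ext j; simpa using congrFun h j)
  have := G.le_graphSpectralRadius (μ := graphSpectralRadius G - hM.eigenvalues i) hne ?_
  · simpa using this
  · intro v
    have := congrFun hv v
    simp only [Matrix.sub_mulVec, Matrix.smul_mulVec, Matrix.one_mulVec, Pi.sub_apply,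
      Pi.smul_apply, smul_eq_mul, adjMatrix_mulVec_apply] at this
    linarith

/-- Replacing an eigenvector `x` by `|x|` cannot increase the positive semidefinite form of `ρ - A`,
which vanishes at `x`. So it vanishes at `|x|`, which therefore lies in the kernel. -/
theorem exists_nonneg_eigenvector [Nonempty V] : ∃ x : V → ℝ, (∀ v, 0 ≤ x v) ∧ 0 < ∑ v, x v ∧
    ∀ v, ∑ u ∈ G.neighborFinset v, x u = graphSpectralRadius G * x v := by
  obtain ⟨x, hx, hx0⟩ := (graphSpectralRadius_isGreatest G).1.exists_hasEigenvector
  rw [Module.End.mem_eigenspace_iff, Matrix.toLin'_apply] at hx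
  have hP := G.posSemidef_graphSpectralRadius_sub_adjMatrix
  have hexp : ∀ y : V → ℝ,
      star y ⬝ᵥ ((graphSpectralRadius G • (1 : Matrix V V ℝ) - G.adjMatrix ℝ).mulVec y) =
      ∑ v, (graphSpectralRadius G * (y v * y v) - ∑ u ∈ G.neighborFinset v, y v * y u) := by
    intro y
    simp only [dotProduct, Matrix.sub_mulVec, Matrix.smul_mulVec, Matrix.one_mulVec, Pi.sub_apply,
      Pi.smul_apply, smul_eq_mul, adjMatrix_mulVec_apply, star_trivial, ← Finset.mul_sum]
    exact Finset.sum_congr rfl fun v _ => by ring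
  have hzero : (graphSpectralRadius G • (1 : Matrix V V ℝ) - G.adjMatrix ℝ).mulVec
      (fun v => |x v|) = 0 := by
    rw [← hP.dotProduct_mulVec_zero_iff]
    refine le_antisymm ?_ (hP.dotProduct_mulVec_nonneg _)
    have h0 := hexp x
    rw [Matrix.sub_mulVec, hx, Matrix.smul_mulVec, Matrix.one_mulVec, sub_self,
      dotProduct_zero] at h0
    rw [hexp, h0]
    refine Finset.sum_le_sum fun v _ => ?_
    rw [abs_mul_abs_self]
    refine sub_le_sub_left (Finset.sum_le_sum fun u _ => ?_) _
    rw [← abs_mul]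
    exact le_abs_self _
  refine ⟨fun v => |x v|, fun v => abs_nonneg _, ?_, fun v => ?_⟩
  · obtain ⟨v, hv⟩ := Function.ne_iff.1 hx0
    exact Finset.sum_pos' (fun _ _ => abs_nonneg _) ⟨v, Finset.mem_univ v, abs_pos.2 hv⟩
  · have := congrFun hzero v
    simp only [Matrix.sub_mulVec, Matrix.smul_mulVec, Matrix.one_mulVec, Pi.sub_apply,
      Pi.smul_apply, smul_eq_mul, adjMatrix_mulVec_apply, Pi.zero_apply] at this
    linarith

omit [DecidableEq V] in
theorem sum_mul_sum_neighborFinset {x : V → ℝ} {μ : ℝ}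
    (hx : ∀ v, ∑ u ∈ G.neighborFinset v, x u = μ * x v) (f : V → ℝ) :
    ∑ v, x v * ∑ u ∈ G.neighborFinset v, f u = μ * ∑ v, x v * f v := by
  simp only [Finset.mul_sum, neighborFinset_eq_filter, Finset.sum_filter]
  rw [Finset.sum_comm]
  refine Finset.sum_congr rfl fun v _ => ?_
  rw [← mul_assoc, ← hx, neighborFinset_eq_filter, Finset.sum_filter, Finset.sum_mul]
  exact Finset.sum_congr rfl fun u _ => by simp [G.adj_comm]

end SimpleGraph

/-! ### Polynomial bounds on the spectral radius -/

namespace IsCactus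
open SimpleGraph
variable {V : Type*} {G : SimpleGraph V} [Fintype V] [Nonempty V]

theorem graphSpectralRadius_sq_sub_le (hG : IsCactus G) :
    graphSpectralRadius G ^ 2 - graphSpectralRadius G ≤ (Fintype.card V : ℝ) - 1 := by
  classical
  obtain ⟨x, hx0, hxpos, hx⟩ := G.exists_nonneg_eigenvector
  have h1 := G.sum_mul_sum_neighborFinset hx fun _ => 1
  have h2 := G.sum_mul_sum_neighborFinset hx fun v => (G.degree v : ℝ)
  simp only [Finset.sum_const, card_neighborFinset_eq_degree, nsmul_eq_mul, mul_one] at h1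
  rw [h1] at h2
  have h3 : ∑ v, x v * ∑ u ∈ G.neighborFinset v, (G.degree u : ℝ) ≤
      ∑ v, x v * ((Fintype.card V : ℝ) - 1 + G.degree v) := by
    refine Finset.sum_le_sum fun v _ => mul_le_mul_of_nonneg_left ?_ (hx0 v)
    have := hG.sum_degree_neighborFinset_le v
    have hpos : 1 ≤ Fintype.card V := Fintype.card_pos
    rw [← Nat.cast_le (α := ℝ)] at this
    push_cast [hpos] at this
    exact this
  simp only [mul_add, Finset.sum_add_distrib, ← Finset.sum_mul, h1, h2] at h3
  refine le_of_mul_le_mul_right ?_ hxpos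
  linarith

theorem graphSpectralRadius_cubic_le (hG : IsCactus G) (hn : Even (Fintype.card V))
    (hadj : ∀ v, ∃ u, G.Adj v u) :
    graphSpectralRadius G ^ 3 - graphSpectralRadius G ^ 2 -
      ((Fintype.card V : ℝ) - 1) * graphSpectralRadius G + 1 ≤ 0 := by
  classical
  obtain ⟨x, hx0, hxpos, hx⟩ := G.exists_nonneg_eigenvector
  -- `D` is the defect in the two-step walk count; its integrality turns strict positivity into `D u
  -- ≥ 1`.
  set D : V → ℝ := fun v => (Fintype.card V : ℝ) - 1 + G.degree v -
    ∑ u ∈ G.neighborFinset v, (G.degree u : ℝ) with hD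
  have hpos : 1 ≤ Fintype.card V := Fintype.card_pos
  have hD0 : ∀ v, 0 ≤ D v := fun v => by
    have := hG.sum_degree_neighborFinset_le v
    rw [← Nat.cast_le (α := ℝ)] at this
    push_cast [hpos] at this
    exact sub_nonneg.2 this
  have hD1 : ∀ v, 1 ≤ ∑ u ∈ G.neighborFinset v, D u := fun v => by
    obtain ⟨u, hvu, hu⟩ := hG.exists_adj_sum_degree_lt hn (hadj v)
    rw [← Nat.succ_le_iff, ← Nat.cast_le (α := ℝ)] at hu
    push_cast [hpos] at hu
    have : 1 ≤ D u := by
      simp only [hD]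
      linarith
    exact this.trans (Finset.single_le_sum (fun w _ => hD0 w) ((mem_neighborFinset _ _ _).2 hvu))
  have h1 := G.sum_mul_sum_neighborFinset hx fun _ => 1
  have h2 := G.sum_mul_sum_neighborFinset hx fun v => (G.degree v : ℝ)
  have h3 := G.sum_mul_sum_neighborFinset hx D
  simp only [Finset.sum_const, card_neighborFinset_eq_degree, nsmul_eq_mul, mul_one] at h1
  rw [h1] at h2
  have h4 : ∑ v, x v ≤ ∑ v, x v * ∑ u ∈ G.neighborFinset v, D u :=
    Finset.sum_le_sum fun v _ => le_mul_of_one_le_right (hx0 v) (hD1 v)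
  have h5 : ∑ v, x v * D v = ((Fintype.card V : ℝ) - 1) * ∑ v, x v +
      graphSpectralRadius G * ∑ v, x v - graphSpectralRadius G * (graphSpectralRadius G * ∑ v, x v) := by
    simp only [hD, mul_sub, mul_add, Finset.sum_add_distrib, Finset.sum_sub_distrib,
      ← Finset.sum_mul, h1, h2]
    ring
  rw [h3, h5] at h4
  refine le_of_mul_le_mul_right ?_ hxpos
  linarith

end IsCactus


/-! ### Windmill graphs -/

/-- The graph in which `c` is joined to all other vertices and any other vertex `a` is joined
to `s a`. -/
def windmill {V : Type*} (c : V) (s : V → V) : SimpleGraph V :=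
  SimpleGraph.fromRel fun a b => a = c ∨ s a = b

namespace windmill
open SimpleGraph
variable {V : Type*} {c : V} {s : V → V}

theorem exists_involutive [Fintype V] {α : Type*} [Fintype α] {k : ℕ}
    (h : Fintype.card V = Fintype.card α + 2 * k) :
    ∃ (f : α ↪ V) (s : V → V), Function.Involutive s ∧ ∀ v, s v = v ↔ v ∈ Set.range f := by
  obtain ⟨e⟩ : Nonempty (V ≃ α ⊕ Fin k × Bool) := by
    rw [← Fintype.card_eq]
    simp [h, mul_comm]
  refine ⟨Function.Embedding.inl.trans e.symm.toEmbedding,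
    fun v => e.symm (Sum.map id (Prod.map id not) (e v)), fun v => ?_, fun v => ?_⟩
  · rcases h : e v with a | ⟨i, b⟩ <;> simp [Equiv.symm_apply_eq, h]
  · rw [Equiv.symm_apply_eq]
    rcases h : e v with a | ⟨i, b⟩
    all_goals simp [Equiv.symm_apply_eq, h]

theorem adj_center {a : V} (h : a ≠ c) : (windmill c s).Adj c a := by
  simp [windmill, h.symm]

theorem adj_iff (hs : Function.Involutive s) {a b : V} (ha : a ≠ c) :
    (windmill c s).Adj a b ↔ a ≠ b ∧ (b = c ∨ b = s a) := by
  have : s b = a ↔ b = s a := ⟨fun h => h ▸ (hs b).symm, fun h => h ▸ hs a⟩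
  simp only [windmill, fromRel_adj, ha, false_or, this]
  tauto

theorem apply_ne_center (hs : Function.Involutive s) (hc : s c = c) {a : V} (ha : a ≠ c) :
    s a ≠ c := fun h => ha (by rw [← hs a, h, hc])

theorem connected : (windmill c s).Connected := by
  have : ∀ a, (windmill c s).Reachable c a := fun a => by
    by_cases h : a = c
    · rw [h]
    · exact (adj_center h).reachable
  exact { preconnected := fun a b => (this a).symm.trans (this b), nonempty := ⟨c⟩ }

/-- A vertex `a ≠ c` has no neighbours besides `c` and `s a`, so a cycle through `a` uses both. As
`c` also has degree two on the cycle, `{c, a, s a}` is closed under adjacency in the cycle, and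
connectedness leaves no room for more. -/
theorem toSubgraph_eq (hs : Function.Involutive s) (hc : s c = c) {u a : V}
    {p : (windmill c s).Walk u u} (hp : p.IsCycle) (ha : a ≠ c) (hap : a ∈ p.support) :
    p.toSubgraph = (⊤ : (windmill c s).Subgraph).induce {c, a, s a} := by
  classical
  have hnbr : ∀ a ∈ p.support, a ≠ c → p.toSubgraph.neighborSet a = {c, s a} := by
    intro a hap ha
    refine Set.eq_of_subset_of_ncard_le (fun b hb => ?_) ?_ (Set.toFinite _)
    · exact ((adj_iff hs ha).1 (p.toSubgraph.adj_sub hb)).2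
    · rw [hp.ncard_neighborSet_toSubgraph_eq_two hap]
      exact (Set.ncard_insert_le _ _).trans (by simp)
  have hac : p.toSubgraph.Adj a c := by
    rw [← Subgraph.mem_neighborSet, hnbr a hap ha]
    exact Or.inl rfl
  have has : p.toSubgraph.Adj a (s a) := by
    rw [← Subgraph.mem_neighborSet, hnbr a hap ha]
    exact Or.inr rfl
  have hsa : s a ∈ p.support := by
    rw [← Walk.mem_verts_toSubgraph]
    exact p.toSubgraph.edge_vert has.symm
  have hcp : c ∈ p.support := by
    rw [← Walk.mem_verts_toSubgraph]
    exact p.toSubgraph.edge_vert hac.symm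
  have hsac : p.toSubgraph.Adj (s a) c := by
    rw [← Subgraph.mem_neighborSet, hnbr _ hsa (apply_ne_center hs hc ha)]
    exact Or.inl rfl
  have hcnbr : p.toSubgraph.neighborSet c = {a, s a} := by
    refine (Set.eq_of_subset_of_ncard_le (fun b hb => ?_) ?_ ?_).symm
    · rcases hb with rfl | rfl
      exacts [hac.symm, hsac.symm]
    · rw [hp.ncard_neighborSet_toSubgraph_eq_two hcp, Set.ncard_pair has.ne]
    · exact Set.finite_of_ncard_ne_zero (by simp [hp.ncard_neighborSet_toSubgraph_eq_two hcp])
  have hclosed : ∀ x ∈ ({c, a, s a} : Set V), ∀ y, p.toSubgraph.Adj x y →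
      y ∈ ({c, a, s a} : Set V) := by
    intro x hx y hxy
    rw [← Subgraph.mem_neighborSet] at hxy
    rcases hx with rfl | rfl | rfl
    · rw [hcnbr] at hxy
      exact Or.inr hxy
    · rw [hnbr _ hap ha] at hxy
      rcases hxy with rfl | rfl <;> simp
    · rw [hnbr _ hsa (apply_ne_center hs hc ha), hs a] at hxy
      rcases hxy with rfl | rfl <;> simp
  have hverts : ∀ y, y ∈ p.support → y ∈ ({c, a, s a} : Set V) := by
    intro y hy
    by_contra hyS
    have hy' : y ∈ (p.rotate a hap).support := by
      rw [← Walk.mem_verts_toSubgraph, Walk.toSubgraph_rotate, Walk.mem_verts_toSubgraph]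
      exact hy
    obtain ⟨d, hd, hd1, hd2⟩ := ((p.rotate a hap).takeUntil y hy').exists_boundary_dart
      {c, a, s a} (by simp) hyS
    refine hd2 (hclosed _ hd1 _ ?_)
    rw [← Walk.toSubgraph_rotate p hap, Walk.adj_toSubgraph_iff_mem_edges]
    exact Walk.edges_takeUntil_subset_edges _ hy' (List.mem_map_of_mem hd)
  ext x y
  · rw [Walk.mem_verts_toSubgraph]
    refine ⟨hverts x, ?_⟩
    rintro (rfl | rfl | rfl) <;> assumption
  · simp only [Subgraph.induce_adj, Subgraph.top_adj]
    constructor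
    · intro h
      exact ⟨hverts _ (Walk.mem_support_of_adj_toSubgraph h),
        hverts _ (Walk.mem_support_of_adj_toSubgraph h.symm), p.toSubgraph.adj_sub h⟩
    · rintro ⟨rfl | rfl | rfl, rfl | rfl | rfl, hxy⟩
      all_goals first
        | exact absurd rfl hxy.ne
        | assumption
        | (apply Subgraph.Adj.symm; assumption)

theorem isCactus (hs : Function.Involutive s) (hc : s c = c) : IsCactus (windmill c s) := by
  intro u v p q hp hq hpq
  have key : ∀ a, a ∈ p.support → a ∈ q.support → a = c := fun a hap haq => by
    by_contra ha
    exact hpq ((toSubgraph_eq hs hc hp ha hap).trans (toSubgraph_eq hs hc hq ha haq).symm)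
  exact fun a ha b hb => (key a ha.1 ha.2).trans (key b hb.1 hb.2).symm

variable [Fintype V] [DecidableEq V] [DecidableRel (windmill c s).Adj]

theorem neighborFinset_center : (windmill c s).neighborFinset c = Finset.univ.erase c := by
  ext a
  rw [mem_neighborFinset, Finset.mem_erase]
  exact ⟨fun h => ⟨h.ne', Finset.mem_univ a⟩, fun h => adj_center h.1⟩

theorem neighborFinset_of_ne (hs : Function.Involutive s) {a : V}
    (ha : a ≠ c) (hsa : s a ≠ a) : (windmill c s).neighborFinset a = {c, s a} := by
  ext b
  simp only [mem_neighborFinset, adj_iff hs ha, Finset.mem_insert, Finset.mem_singleton]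
  refine ⟨And.right, fun h => ⟨?_, h⟩⟩
  rcases h with rfl | rfl
  exacts [ha, hsa.symm]

omit [DecidableEq V] in
theorem neighborFinset_of_fixed (hs : Function.Involutive s) {a : V}
    (ha : a ≠ c) (hsa : s a = a) : (windmill c s).neighborFinset a = {c} := by
  ext b
  simp only [mem_neighborFinset, adj_iff hs ha, Finset.mem_singleton, hsa]
  grind

end windmill

/-! ### The edge bound for connected cacti -/

namespace IsCactus
open SimpleGraph
variable {V : Type*} {G : SimpleGraph V}

theorem eq_of_mem_edges (hG : IsCactus G) {u v : V} {p : G.Walk u u} {q : G.Walk v v}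
    (hp : p.IsCycle) (hq : q.IsCycle) {e : Sym2 V} (hep : e ∈ p.edges) (heq : e ∈ q.edges) :
    p.toSubgraph = q.toSubgraph := by
  by_contra hne
  induction e with
  | _ a b =>
    exact (p.adj_of_mem_edges hep).ne (hG p q hp hq hne
      ⟨p.fst_mem_support_of_mem_edges hep, q.fst_mem_support_of_mem_edges heq⟩
      ⟨p.snd_mem_support_of_mem_edges hep, q.snd_mem_support_of_mem_edges heq⟩)

/-- Each edge outside a spanning tree closes a fundamental cycle with at least two tree edges.
Cycles of a cactus sharing an edge coincide, so these sets of tree edges are disjoint, and at most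
half of `n - 1` edges lie outside the tree. -/
theorem two_mul_ncard_edgeSet_le [Fintype V] (hG : IsCactus G) (hconn : G.Connected) :
    2 * G.edgeSet.ncard ≤ 3 * (Fintype.card V - 1) := by
  classical
  obtain ⟨T, hTG, hT⟩ := hconn.exists_isTree_le
  have hTcard := hT.card_edgeFinset
  have hcyc : ∀ e ∈ G.edgeFinset \ T.edgeFinset, ∃ p : Σ v, G.Walk v v, p.2.IsCycle ∧
      e ∈ p.2.edges ∧ ∀ e' ∈ p.2.edges, e' ≠ e → e' ∈ T.edgeFinset := by
    intro e he
    induction e with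
    | _ a b =>
      simp only [Finset.mem_sdiff, mem_edgeFinset, mem_edgeSet] at he
      obtain ⟨p, hp⟩ := (hT.connected.preconnected b a).exists_isPath
      have hpT : ∀ e ∈ (p.mapLe hTG).edges, e ∈ T.edgeFinset := by
        intro e hep
        rw [Walk.edges_mapLe_eq_edges] at hep
        exact mem_edgeFinset.2 (p.edges_subset_edgeSet hep)
      refine ⟨⟨a, .cons he.1 (p.mapLe hTG)⟩, ?_, by simp, ?_⟩
      · rw [Walk.cons_isCycle_iff, Walk.isPath_mapLe]
        exact ⟨hp, fun h => he.2 (mem_edgeFinset.1 (hpT _ h))⟩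
      · intro e' he' hne
        rw [Walk.edges_cons, List.mem_cons] at he'
        exact hpT e' (he'.resolve_left hne)
  have : Nonempty (Σ v, G.Walk v v) := hconn.nonempty.map fun v => ⟨v, .nil⟩
  choose! p hp hep hpT using hcyc
  set P : Sym2 V → Finset (Sym2 V) := fun e => (p e).2.edges.toFinset.erase e with hP
  have hPcard : ∀ e ∈ G.edgeFinset \ T.edgeFinset, 2 ≤ (P e).card := by
    intro e he
    have h1 : (p e).2.edges.toFinset.card = (p e).2.length := by
      rw [List.toFinset_card_of_nodup (hp e he).isTrail.edges_nodup, Walk.length_edges]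
    rw [hP, Finset.card_erase_of_mem (List.mem_toFinset.2 (hep e he)), h1]
    have := (hp e he).three_le_length
    omega
  have hdisj : ((G.edgeFinset \ T.edgeFinset : Finset (Sym2 V)) : Set (Sym2 V)).PairwiseDisjoint
      P := by
    intro e he e' he' hne
    rw [Function.onFun, Finset.disjoint_left]
    intro d hd hd'
    rw [Finset.mem_coe] at he he'
    simp only [hP, Finset.mem_erase, List.mem_toFinset] at hd hd'
    have heq := hG.eq_of_mem_edges (hp e he) (hp e' he') hd.2 hd'.2
    have h1 : e' ∈ (p e).2.edges := by
      rw [← Walk.mem_edges_toSubgraph, heq, Walk.mem_edges_toSubgraph]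
      exact hep e' he'
    exact (Finset.mem_sdiff.1 he').2 (hpT e he e' h1 hne.symm)
  have hsub : (G.edgeFinset \ T.edgeFinset).biUnion P ⊆ T.edgeFinset := by
    intro d hd
    simp only [Finset.mem_biUnion, hP, Finset.mem_erase, List.mem_toFinset] at hd
    obtain ⟨e, he, hne, hd⟩ := hd
    exact hpT e he d hd hne
  have h1 := Finset.card_le_card hsub
  rw [Finset.card_biUnion hdisj] at h1
  have h2 := Finset.card_nsmul_le_sum _ _ _ hPcard
  have h3 := Finset.card_sdiff_add_card_eq_card (edgeFinset_mono hTG)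
  rw [smul_eq_mul] at h2
  rw [Set.ncard_eq_toFinset_card', ← edgeFinset]
  omega

end IsCactus

/-! ### Extremality and eigenvectors of windmills -/

namespace windmill
open SimpleGraph
variable {V : Type*} [Fintype V] {c : V} {s : V → V}

theorem isMaximumConnectedCactus (hs : Function.Involutive s) (hc : s c = c)
    (hfix : ∃ d, ∀ v, s v = v → v = c ∨ v = d) :
    IsMaximumConnectedCactus (windmill c s) := by
  classical
  refine ⟨connected, isCactus hs hc, fun H hH hHc => ?_⟩
  have h1 := hHc.two_mul_ncard_edgeSet_le hH
  have h2 := (windmill c s).sum_degrees_eq_twice_card_edges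
  have hcard : (windmill c s).edgeSet.ncard = (windmill c s).edgeFinset.card := by
    rw [Set.ncard_eq_toFinset_card', ← edgeFinset]
  obtain ⟨d, hd⟩ := hfix
  -- The correction term pays for the possible pendant vertex `d`. Twice the number of edges is then
  -- at least `3(n - 1) - 1`, and the loss of one disappears after halving.
  have hdeg : ∀ v ∈ Finset.univ.erase c,
      2 ≤ (windmill c s).degree v + if v = d then 1 else 0 := by
    intro v hv
    have hvc := Finset.ne_of_mem_erase hv
    rw [← card_neighborFinset_eq_degree]
    by_cases hsv : s v = v
    · rw [neighborFinset_of_fixed hs hvc hsv, if_pos ((hd v hsv).resolve_left hvc),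
        Finset.card_singleton]
    · rw [neighborFinset_of_ne hs hvc hsv,
        Finset.card_pair (apply_ne_center hs hc hvc).symm]
      exact Nat.le_add_right _ _
  have h3 := Finset.card_nsmul_le_sum _ _ _ hdeg
  have h4 : ∑ v ∈ Finset.univ.erase c, (if v = d then 1 else 0) ≤ 1 := by
    rw [Finset.sum_ite_eq']
    split_ifs <;> simp
  rw [Finset.sum_add_distrib, Finset.card_erase_of_mem (Finset.mem_univ c), Finset.card_univ,
    smul_eq_mul] at h3
  rw [← Finset.add_sum_erase _ _ (Finset.mem_univ c), ← card_neighborFinset_eq_degree,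
    neighborFinset_center, Finset.card_erase_of_mem (Finset.mem_univ c), Finset.card_univ] at h2
  omega

theorem le_graphSpectralRadius_of_sq (hs : Function.Involutive s) (hc : s c = c)
    (hfix : ∀ v, s v = v → v = c) (hV : ∃ a, a ≠ c) {θ : ℝ} (hθ : θ ^ 2 - θ = (Fintype.card V : ℝ) - 1) :
    θ ≤ graphSpectralRadius (windmill c s) := by
  classical
  have : Nonempty V := ⟨c⟩
  have hpos : 1 ≤ Fintype.card V := Fintype.card_pos
  have hcard : ((Finset.univ.erase c).card : ℝ) = (Fintype.card V : ℝ) - 1 := by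
    rw [Finset.card_erase_of_mem (Finset.mem_univ c), Finset.card_univ]
    push_cast [hpos]
    rfl
  obtain ⟨a, ha⟩ := hV
  refine (windmill c s).le_graphSpectralRadius (x := fun v => if v = c then θ - 1 else 1)
    (Function.ne_iff.2 ⟨a, by simp [ha]⟩) fun v => ?_
  by_cases hv : v = c
  · subst hv
    rw [neighborFinset_center, Finset.sum_congr rfl (g := fun _ => (1 : ℝ))
      fun w hw => if_neg (Finset.ne_of_mem_erase hw), Finset.sum_const, nsmul_eq_mul, hcard]
    simp only [if_true]
    linarith
  · rw [neighborFinset_of_ne hs hv (fun h => hv (hfix v h)),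
      Finset.sum_pair (apply_ne_center hs hc hv).symm]
    simp [hv, apply_ne_center hs hc hv]

theorem le_graphSpectralRadius_of_cubic (hs : Function.Involutive s) (hc : s c = c) {d : V}
    (hd : s d = d) (hdc : d ≠ c) (hfix : ∀ v, s v = v → v = c ∨ v = d) {θ : ℝ}
    (hθ : θ ^ 3 - θ ^ 2 - ((Fintype.card V : ℝ) - 1) * θ + 1 = 0) :
    θ ≤ graphSpectralRadius (windmill c s) := by
  classical
  have : Nonempty V := ⟨c⟩
  have hcard : (((Finset.univ.erase c).erase d).card : ℝ) = (Fintype.card V : ℝ) - 2 := by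
    have h1 := Finset.card_erase_add_one (Finset.mem_univ c)
    have h2 := Finset.card_erase_add_one (Finset.mem_erase.2 ⟨hdc, Finset.mem_univ d⟩)
    rw [← Finset.card_univ, ← h1, ← h2]
    push_cast
    ring
  -- The eigenvalue equations at `d` and at the triangle vertices fix these values up to scale; the
  -- one at `c` is the cubic.
  set x : V → ℝ := fun v => if v = c then θ * (θ - 1) else if v = d then θ - 1 else θ with hx
  have hxc : x c = θ * (θ - 1) := by simp [hx]
  have hxd : x d = θ - 1 := by simp [hx, hdc]
  have hxv : ∀ v, v ≠ c → v ≠ d → x v = θ := fun v h1 h2 => by simp [hx, h1, h2]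
  -- The vector vanishes only if `θ = 1`; the cubic then gives `n = 2`, where the all-ones vector
  -- serves instead.
  by_cases h0 : x = 0
  · have h1 : θ = 1 := by
      have := congrFun h0 d
      rw [hxd, Pi.zero_apply] at this
      linarith
    subst h1
    have h2 : ((Finset.univ.erase c).erase d).card = 0 := by
      rw [← Nat.cast_eq_zero (R := ℝ), hcard]
      linarith
    rw [Finset.card_eq_zero] at h2
    have hne : ∀ v, v ≠ c → v = d := fun v hv => by
      by_contra hvd
      have : v ∈ (Finset.univ.erase c).erase d := by simp [hv, hvd]
      simp [h2] at this
    have huniv : Finset.univ.erase c = {d} := by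
      ext v
      simp only [Finset.mem_erase, Finset.mem_univ, and_true, Finset.mem_singleton]
      exact ⟨hne v, fun h => h ▸ hdc⟩
    refine (windmill c s).le_graphSpectralRadius (x := fun _ => 1)
      (Function.ne_iff.2 ⟨c, by simp⟩) fun v => ?_
    by_cases hv : v = c
    · subst hv
      rw [neighborFinset_center, huniv]
      simp
    · rw [hne v hv, neighborFinset_of_fixed hs hdc hd]
      simp
  refine (windmill c s).le_graphSpectralRadius h0 fun v => ?_
  by_cases hv : v = c
  · subst hv
    rw [neighborFinset_center, ← Finset.add_sum_erase _ _
      (Finset.mem_erase.2 ⟨hdc, Finset.mem_univ d⟩), hxc, hxd,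
      Finset.sum_congr rfl (g := fun _ => θ), Finset.sum_const, nsmul_eq_mul, hcard]
    · linarith
    · intro w hw
      simp only [Finset.mem_erase] at hw
      exact hxv w hw.2.1 hw.1
  by_cases hvd : v = d
  · subst hvd
    rw [neighborFinset_of_fixed hs hv hd, Finset.sum_singleton, hxc, hxd]
  · have hsv : s v ≠ v := fun h => (hfix v h).elim hv hvd
    have hsd : s v ≠ d := fun h => hvd (by rw [← hs v, h, hd])
    rw [neighborFinset_of_ne hs hv hsv, Finset.sum_pair (apply_ne_center hs hc hv).symm, hxc,
      hxv _ hv hvd, hxv _ (apply_ne_center hs hc hv) hsd]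
    ring

end windmill

/-! ### Comparison with the windmill -/

theorem exists_ge_eq_zero {f : ℝ → ℝ} (hf : Continuous f) {a b : ℝ} (hab : a ≤ b) (ha : f a ≤ 0)
    (hb : 0 ≤ f b) : ∃ t, a ≤ t ∧ f t = 0 := by
  obtain ⟨t, ht, h⟩ := intermediate_value_Icc hab hf.continuousOn ⟨ha, hb⟩
  exact ⟨t, ht.1, h⟩

theorem exists_isMaximumConnectedCactus_of_odd {V : Type*} [Fintype V] [Nontrivial V]
    {G : SimpleGraph V} (hG : IsCactus G) (hn : Odd (Fintype.card V)) :
    ∃ G' : SimpleGraph V, IsMaximumConnectedCactus G' ∧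
      graphSpectralRadius G ≤ graphSpectralRadius G' := by
  obtain ⟨k, hk⟩ := hn
  obtain ⟨f, s, hs, hfix⟩ := windmill.exists_involutive (V := V) (α := Unit) (k := k)
    (by rw [hk, Fintype.card_unit, add_comm])
  have hc : s (f ()) = f () := (hfix _).2 ⟨(), rfl⟩
  have hfix' : ∀ v, s v = v → v = f () := fun v hv => by
    obtain ⟨_, rfl⟩ := (hfix v).1 hv
    rfl
  refine ⟨windmill (f ()) s, windmill.isMaximumConnectedCactus hs hc
    ⟨f (), fun v hv => Or.inl (hfix' v hv)⟩, ?_⟩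
  have hpos : (1 : ℝ) ≤ Fintype.card V := by exact_mod_cast (Fintype.card_pos : 0 < Fintype.card V)
  -- The quadratic is nonpositive at `ρ(G)` and nonnegative at `|ρ(G)| + n`; any root in between is
  -- at most the spectral radius of the windmill.
  obtain ⟨θ, hle, hθ⟩ := exists_ge_eq_zero
    (f := fun t => t ^ 2 - t - ((Fintype.card V : ℝ) - 1)) (by fun_prop)
    (le_add_of_le_of_nonneg (le_abs_self _) (Nat.cast_nonneg (Fintype.card V)))
    (sub_nonpos.2 hG.graphSpectralRadius_sq_sub_le)
    (by nlinarith [abs_nonneg (graphSpectralRadius G)])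
  exact hle.trans (windmill.le_graphSpectralRadius_of_sq hs hc hfix' (exists_ne _)
    (sub_eq_zero.1 hθ))

theorem exists_isMaximumConnectedCactus_of_even {V : Type*} [Fintype V] [Nontrivial V]
    {G : SimpleGraph V} (hG : IsCactus G) (hconn : G.Connected) (hn : Even (Fintype.card V)) :
    ∃ G' : SimpleGraph V, IsMaximumConnectedCactus G' ∧
      graphSpectralRadius G ≤ graphSpectralRadius G' := by
  obtain ⟨k, hk⟩ := hn
  have hcard : 1 < Fintype.card V := Fintype.one_lt_card
  obtain ⟨f, s, hs, hfix⟩ := windmill.exists_involutive (V := V) (α := Bool) (k := k - 1)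
    (by rw [Fintype.card_bool]; omega)
  have hc : ∀ b, s (f b) = f b := fun b => (hfix _).2 ⟨b, rfl⟩
  have hfix' : ∀ v, s v = v → v = f true ∨ v = f false := fun v hv => by
    obtain ⟨b, rfl⟩ := (hfix v).1 hv
    cases b <;> simp
  refine ⟨windmill (f true) s, windmill.isMaximumConnectedCactus hs (hc true)
    ⟨f false, hfix'⟩, ?_⟩
  have hpos : (1 : ℝ) ≤ Fintype.card V := by exact_mod_cast hcard.le
  obtain ⟨θ, hle, hθ⟩ := exists_ge_eq_zero
    (f := fun t => t ^ 3 - t ^ 2 - ((Fintype.card V : ℝ) - 1) * t + 1) (by fun_prop)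
    (le_add_of_le_of_nonneg (le_abs_self _) (Nat.cast_nonneg (Fintype.card V)))
    (hG.graphSpectralRadius_cubic_le ⟨k, hk⟩ hconn.preconnected.exists_adj_of_nontrivial)
    (by
      set M := |graphSpectralRadius G| + Fintype.card V with hM
      have h1 : (Fintype.card V : ℝ) ≤ M := le_add_of_nonneg_left (abs_nonneg _)
      -- The cubic at `M` is this product plus one, and `M ≥ n` makes the product nonnegative.
      have h2 : 0 ≤ M * (M * (M - 1) - ((Fintype.card V : ℝ) - 1)) :=
        mul_nonneg (by linarith) (by nlinarith)
      linarith)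
  exact hle.trans (windmill.le_graphSpectralRadius_of_cubic hs (hc true) (hc false)
    (f.injective.ne (by decide)) hfix' hθ)

theorem theorem2p8 {V : Type*} [Fintype V] (G : SimpleGraph V)
    (hG : IsEdgeMaximalConnectedCactus G) :
    ∃ G' : SimpleGraph V, IsMaximumConnectedCactus G' ∧
      graphSpectralRadius G ≤ graphSpectralRadius G' := by
  rcases subsingleton_or_nontrivial V with hV | hV
  · refine ⟨G, ⟨hG.connected, hG.isCactus, fun H _ _ => ?_⟩, le_rfl⟩
    rw [Subsingleton.elim H G]
  · rcases Nat.even_or_odd (Fintype.card V) with hn | hn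
    · exact exists_isMaximumConnectedCactus_of_even hG.isCactus hG.connected hn
    · exact exists_isMaximumConnectedCactus_of_odd hG.isCactus hn
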